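/- Let $q$ be an indeterminate and write $[m]_q = 1+q+\dots+q^{m-1}$ (so $[0]_q=0$), $[m]_q! = [1]_q[2]_q\cdots[m]_q$ and ${m \brack j}_q = \dfrac{[m]_q!}{[j]_q!\,[m-j]_q!}$ for $0\le j\le m$. For an integer $r\ge 1$, let the $r$-colored $q$-Stirling numbers of the second kind be defined for $n,k\ge 0$ by $S_r[0,k]=\delta_{0k}$ and $S_r[n,k]=S_r[n-1,k-1]+[rk+1]_q\,S_r[n-1,k]$ for $n\ge1$ (with $S_r[n-1,-1]=0$). A colored permutation $\pi\in\mathbb{Z}_r\wr\mathfrak{S}_n$ is a word $\pi=\pi_1^{z_1}\cdots\pi_n^{z_n}$ with $\pi_1\cdots\pi_n\in\mathfrak{S}_n$ and colors $z_i\in\{0,\dots,r-1\}$. Put $\pi_0^{z_0}=0$, write $m=m^0$, and order the letters by $$n^{r-1}<\cdots<n^1<\cdots<1^{r-1}<\cdots<1^1<0<1<\cdots<n .$$ Let $\mathrm{Des}_r(\pi)=\{\,i\in\{0,\dots,n-1\} : \pi_i^{z_i}>\pi_{i+1}^{z_{i+1}}\}$, $\mathrm{des}_r(\pi)=|\mathrm{Des}_r(\pi)|$,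 $\mathrm{fmaj}_r(\pi)=r\sum_{i\in\mathrm{Des}_r(\pi)}i+\sum_{i=1}^n z_i$, and let $A^r_{n,\ell}(q)=\sum_{\pi}q^{\mathrm{fmaj}_r(\pi)}$, the sum being over the $\pi\in\mathbb{Z}_r\wr\mathfrak{S}_n$ with $\mathrm{des}_r(\pi)=\ell$. **Theorem.** (i) For all integers $r\ge 1$ and $0\le k\le n$, $$q^{r\binom{k+1}{2}+(1-r)k}\,[r]_q^k\,[k]_{q^r}!\,S_r[n,k]=\sum_{\ell=0}^{k}q^{rk(k-\ell)}A^r_{n,\ell}(q){n-\ell\brack k-\ell}_{q^r}.$$ (ii) (Type A, $r=1$.) Let $S[n,k]$ be given by $S[0,k]=\delta_{0k}$ and $S[n,k]=S[n-1,k-1]+[k]_q S[n-1,k]$ (with $S[n-1,-1]=0$), and let $A_{n,\ell}(q)=\sum q^{\mathrm{maj}(\pi)}$ over the $\pi\in\mathfrak{S}_n$ with $\ell$ descents, where a descent is an $i\in\{1,\dots,n-1\}$ with $\pi_i>\pi_{i+1}$ and $\mathrm{maj}(\pi)$ is the sum of the descents of $\pi$. Then $S_1[n,k]=S[n+1,k+1]$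 and $A^1_{n,\ell}(q)=A_{n,\ell}(q)$ for all $n,k,\ell\ge 0$, and for $n\ge1$ and $0\le k\le n$, $$q^{\binom k2}[k]_q!\,S[n,k]=\sum_{\ell=1}^{k}q^{k(k-\ell)}A_{n,\ell-1}(q){n-\ell\brack k-\ell}_q .$$ (iii) (Type B, $r=2$.) Let $S_B[n,k]$ be given by $S_B[0,k]=\delta_{0k}$ and $S_B[n,k]=S_B[n-1,k-1]+[2k+1]_q S_B[n-1,k]$ (with $S_B[n-1,-1]=0$). Let $\mathcal{B}_n$ be the set of permutations $\pi$ of $\{-n,\dots,-1,1,\dots,n\}$ with $\pi(-i)=-\pi(i)$; write $\pi_i=\pi(i)$, $\pi_0=0$, $\mathrm{Des}_B(\pi)=\{i\in\{0,\dots,n-1\}:\pi_i>\pi_{i+1}\}$ and $\mathrm{fmaj}(\pi)=\sum_{i\in\mathrm{Des}_B(\pi)}2i+|\{i\in\{1,\dots,n\}:\pi_i<0\}|$, and let $B_{n,\ell}(q)=\sum q^{\mathrm{fmaj}(\pi)}$ over the $\pi\in\mathcal{B}_n$ with $|\mathrm{Des}_B(\pi)|=\ell$. Then $S_2[n,k]=S_B[n,k]$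 and $A^2_{n,\ell}(q)=B_{n,\ell}(q)$ for all $n,k,\ell\ge0$, and for $0\le k\le n$, $$[2]_q^k\,[k]_{q^2}!\,S_B[n,k]=\sum_{\ell=0}^{k}q^{k(k-2\ell)}B_{n,\ell}(q){n-\ell\brack k-\ell}_{q^2}.$$ -/

import Mathlib

open Finset

namespace QStirlingEulerian

section QAnalogues

/-- The q-integer `[n]_q = 1 + q + ⋯ + q^(n-1)`. -/
def qInt {R : Type*} [CommSemiring R] (q : R) (n : ℕ) : R :=
  ∑ i ∈ range n, q ^ i

/-- The q-factorial `[n]_q! = [1]_q [2]_q ⋯ [n]_q`. -/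
def qFactorial {R : Type*} [CommSemiring R] (q : R) (n : ℕ) : R :=
  ∏ i ∈ Icc 1 n, qInt q i

/-- The q-binomial coefficient `[n]_q! / ([k]_q! [n-k]_q!)`, meant for `0 ≤ k ≤ n`. -/
def qBinomial {K : Type*} [Field K] (q : K) (n k : ℕ) : K :=
  qFactorial q n / (qFactorial q k * qFactorial q (n - k))

end QAnalogues

section Stirling

/-- The triangular array with `T(0,k) = δ_{0k}` and `T(n,k) = T(n-1,k-1) + w(k) T(n-1,k)`,
where `T(n-1,-1) = 0`. -/
def triangle {R : Type*} [CommSemiring R] (w : ℕ → R) : ℕ → ℕ → R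
  | 0, 0 => 1
  | 0, _ + 1 => 0
  | n + 1, 0 => w 0 * triangle w n 0
  | n + 1, k + 1 => triangle w n k + w (k + 1) * triangle w n (k + 1)

/-- The r-colored q-Stirling numbers of the second kind `S_r[n,k]`. -/
def stirlingR {R : Type*} [CommSemiring R] (q : R) (r n k : ℕ) : R :=
  triangle (fun j => qInt q (r * j + 1)) n k

/-- Carlitz's (type A) q-Stirling numbers of the second kind `S[n,k]`. -/
def stirlingA {R : Type*} [CommSemiring R] (q : R) (n k : ℕ) : R :=
  triangle (fun j => qInt q j) n k

/-- The type B q-Stirling numbers of the second kind `S_B[n,k]`. -/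
def stirlingB {R : Type*} [CommSemiring R] (q : R) (n k : ℕ) : R :=
  triangle (fun j => qInt q (2 * j + 1)) n k

end Stirling

section TypeA

/-- The letter `π_i ∈ {1, …, n}` of a permutation, for `1 ≤ i ≤ n`, and `π_0 = 0`.
(`Fin n` stands for `{1, …, n}` by shifting positions and values by one;
the value for `i > n` is irrelevant.) -/
def letter {n : ℕ} (π : Equiv.Perm (Fin n)) : ℕ → ℕ
  | 0 => 0
  | i + 1 => if h : i < n then (π ⟨i, h⟩ : ℕ) + 1 else 0

/-- `Des(π) = {i ∈ [n-1] : π_i > π_{i+1}}`. -/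
def desA {n : ℕ} (π : Equiv.Perm (Fin n)) : Finset ℕ :=
  {i ∈ Ico 1 n | letter π i > letter π (i + 1)}

/-- The major index. -/
def maj {n : ℕ} (π : Equiv.Perm (Fin n)) : ℕ :=
  ∑ i ∈ desA π, i

/-- `A_{n,k}(q)`, the coefficient of `t^k` in `∑_π t^(des π) q^(maj π)`. -/
def eulerianA {R : Type*} [CommSemiring R] (q : R) (n k : ℕ) : R :=
  ∑ π : Equiv.Perm (Fin n) with #(desA π) = k, q ^ maj π

end TypeA

section TypeB

/-- The set `[±n] = {-n, …, -1, 1, …, n}`. -/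
abbrev PlusMinus (n : ℕ) : Type :=
  {i : ℤ // i ∈ (Icc (-(n : ℤ)) n).erase 0}

/-- Signed permutations: permutations of `[±n]` with `π(-i) = -π(i)`. -/
abbrev SignedPerm (n : ℕ) : Type :=
  {π : Equiv.Perm (PlusMinus n) //
    ∀ i j : PlusMinus n, (j : ℤ) = -(i : ℤ) → (π j : ℤ) = -(π i : ℤ)}

/-- `π_i = π(i)` for `i ∈ [±n]`, and `π_0 = 0` (the value for `|i| > n` is irrelevant). -/
noncomputable def SignedPerm.letter {n : ℕ} (π : SignedPerm n) (i : ℤ) : ℤ :=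
  if h : i ∈ (Icc (-(n : ℤ)) n).erase 0 then (π.1 ⟨i, h⟩ : ℤ) else 0

/-- `Des_B(π) = {i ∈ {0, …, n-1} : π_i > π_{i+1}}`. -/
noncomputable def desB {n : ℕ} (π : SignedPerm n) : Finset ℕ :=
  {i ∈ range n | SignedPerm.letter π (i : ℤ) > SignedPerm.letter π ((i : ℤ) + 1)}

/-- The number of `i ∈ [n]` with `π_i < 0`. -/
noncomputable def neg {n : ℕ} (π : SignedPerm n) : ℕ :=
  #((Icc 1 n).filter fun i : ℕ => SignedPerm.letter π (i : ℤ) < 0)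

/-- The flag-major index of a signed permutation. -/
noncomputable def fmajB {n : ℕ} (π : SignedPerm n) : ℕ :=
  (∑ i ∈ desB π, 2 * i) + neg π

/-- `B_{n,k}(q)`, the coefficient of `t^k` in `∑_π t^(des_B π) q^(fmaj π)`. -/
noncomputable def eulerianB {R : Type*} [CommSemiring R] (q : R) (n k : ℕ) : R :=
  ∑ π : SignedPerm n with #(desB π) = k, q ^ fmajB π

end TypeB

section Colored

/-- Colored permutations `π = π_1^{z_1} ⋯ π_n^{z_n}`, the elements of `ℤ_r ≀ 𝔖_n`:
a permutation of the `n` letters with a color `z_i ∈ {0, …, r-1}` for each position. -/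
abbrev ColoredPerm (r n : ℕ) : Type :=
  Equiv.Perm (Fin n) × (Fin n → Fin r)

/-- The color `z_i` for `1 ≤ i ≤ n` (and `z_0 = 0`; the value for `i > n` is irrelevant). -/
def color {r n : ℕ} (z : Fin n → Fin r) : ℕ → ℕ
  | 0 => 0
  | i + 1 => if h : i < n then (z ⟨i, h⟩ : ℕ) else 0

/-- The rank of the colored letter `m^c` in the total order
`n^{r-1} < ⋯ < n^1 < ⋯ < 1^{r-1} < ⋯ < 1^1 < 0 < 1 < ⋯ < n` (`m = m^0`):
the letter `m^0` goes to `(m, 0)`, and `m^c` with `c > 0` goes to `(-m, -c)`,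
in the lexicographic order. -/
def rank (m c : ℕ) : ℤ ×ₗ ℤ :=
  if c = 0 then toLex ((m : ℤ), (0 : ℤ)) else toLex (-(m : ℤ), -(c : ℤ))

/-- `π_i^{z_i}`, seen in the total order of colored letters; it is `0` for `i = 0`. -/
def coloredLetter {r n : ℕ} (π : ColoredPerm r n) (i : ℕ) : ℤ ×ₗ ℤ :=
  rank (letter π.1 i) (color π.2 i)

/-- `Des_r(π) = {i ∈ {0, …, n-1} : π_i^{z_i} > π_{i+1}^{z_{i+1}}}`. -/
def desR {r n : ℕ} (π : ColoredPerm r n) : Finset ℕ :=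
  {i ∈ range n | coloredLetter π i > coloredLetter π (i + 1)}

/-- The r-flag-major index `r ∑_{i ∈ Des_r(π)} i + ∑_{i=1}^n z_i`. -/
def fmajR {r n : ℕ} (π : ColoredPerm r n) : ℕ :=
  r * (∑ i ∈ desR π, i) + ∑ i : Fin n, (π.2 i : ℕ)

/-- `A^r_{n,k}(q)`, the coefficient of `t^k` in `∑_π t^(des_r π) q^(fmaj_r π)`. -/
def eulerianR {R : Type*} [CommSemiring R] (q : R) (r n k : ℕ) : R :=
  ∑ π : ColoredPerm r n with #(desR π) = k, q ^ fmajR π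

end Colored

/-- The indeterminate `q`, in the field `ℚ(q)`. -/
noncomputable abbrev qq : RatFunc ℚ := RatFunc.X

end QStirlingEulerian

/-!
The proof compares two expansions of the powers `[rm+1] ^ n`, as functions of `m`.

On the Stirling side, the array `triangle w` consists of the coefficients of `x ^ n` in the Newton
basis `∏_{i<k} (x - w i)`. At `x = [rm+1]`, with nodes `w i = [ri+1]`, that product is, up to the
factor on the left-hand side of the theorem, the Gaussian binomial coefficient `(m choose k)` in
`q ^ r` (`pow_eq_sum_gaussBinom`).

On the Eulerian side there is the Carlitz identity (`genSeries_eq`)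
`∑_π q ^ fmaj(π) t ^ des(π) = ∏_{i≤n} (1 - q ^ (r i) t) ∑_m [rm+1] ^ n t ^ m`,
whose coefficient form expands `[rm+1] ^ n` in the `(n+m-l choose n)` with coefficients `A_{n,l}`.
It is obtained from a refinement by the last colored letter. Appending a letter and
standardizing changes `des` and `fmaj` in a way that depends only on the last two letters
(`weight_snoc`, `lastDescent_snoc`), and the refined series have closed forms (`lastSeries_eq`) that
turn the resulting recursion into sums of geometric progressions.

The `q`-Vandermonde convolution (`gaussBinom_vandermonde`) rewrites `(n+m-l choose n)` in terms of
the `(m choose k)`, and the coefficients of the latter agree because the matrix `(m choose k)` is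
unitriangular (`coeff_eq_of_expansions`). For type A the same comparison is made for `[m] ^ n`,
which for `n ≥ 1` is the case `r = 1` shifted by one. For type B, signed permutations are
identified with 2-colored ones by marking the negative letters (`SignedPerm.toColored`).
-/

namespace QStirlingEulerian

/-! ### Gaussian binomial coefficients -/

section GaussBinom

variable {R : Type*} [CommRing R]

/-- The Gaussian binomial coefficient, defined by the `q`-Pascal rule. Unlike the quotient of
`q`-factorials `qBinomial`, it is meaningful in every ring and vanishes for `k > n`. -/
def gaussBinom (q : R) : ℕ → ℕ → R
  | _, 0 => 1
  | 0, _ + 1 => 0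
  | n + 1, k + 1 => gaussBinom q n k + q ^ (k + 1) * gaussBinom q n (k + 1)

@[simp] lemma gaussBinom_zero_right (q : R) (n : ℕ) : gaussBinom q n 0 = 1 := by
  cases n <;> rfl

lemma gaussBinom_succ_succ (q : R) (n k : ℕ) :
    gaussBinom q (n + 1) (k + 1) = gaussBinom q n k + q ^ (k + 1) * gaussBinom q n (k + 1) := rfl

lemma gaussBinom_eq_zero (q : R) {n k : ℕ} (h : n < k) : gaussBinom q n k = 0 := by
  induction n generalizing k with
  | zero => cases k with
    | zero => omega
    | succ k => rfl
  | succ n ih => cases k with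
    | zero => omega
    | succ k => rw [gaussBinom_succ_succ, ih (by omega), ih (by omega)]; simp

@[simp] lemma gaussBinom_self (q : R) (n : ℕ) : gaussBinom q n n = 1 := by
  induction n with
  | zero => rfl
  | succ n ih => rw [gaussBinom_succ_succ, ih, gaussBinom_eq_zero q (by omega)]; simp

/-- The `q`-Vandermonde convolution, arranged so that no subtraction occurs. In the induction on
`a`, the Pascal rule for `gaussBinom q (a + 1) j` regroups the sum into the one for
`(a, m + 1, l + 1)`. -/
lemma gaussBinom_vandermonde (q : R) (a m l : ℕ) :
    ∑ j ∈ range (a + 1), q ^ ((l + j) * j) * gaussBinom q a j * gaussBinom q m (l + j)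
      = gaussBinom q (a + m) (a + l) := by
  induction a generalizing m l with
  | zero => simp
  | succ a ih =>
    set S : ℕ → R := fun j => q ^ ((l + 1 + j) * j) * gaussBinom q a j * gaussBinom q m (l + j)
      with hS
    set U : ℕ → R := fun j =>
      q ^ ((l + 1 + j) * (j + 1)) * gaussBinom q a j * gaussBinom q m (l + j + 1) with hU
    have hl : ∀ j, q ^ ((l + (j + 1)) * (j + 1)) * gaussBinom q (a + 1) (j + 1)
        * gaussBinom q m (l + (j + 1)) = U j + S (j + 1) := fun j => by
      simp only [hS, hU, gaussBinom_succ_succ, ← add_assoc]; ring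
    have hr : ∀ j, q ^ ((l + 1 + j) * j) * gaussBinom q a j * gaussBinom q (m + 1) (l + 1 + j)
        = U j + S j := fun j => by
      rw [show l + 1 + j = l + j + 1 by ring, gaussBinom_succ_succ]
      simp only [hS, hU]; ring
    have h0 : q ^ ((l + 0) * 0) * gaussBinom q (a + 1) 0 * gaussBinom q m (l + 0) = S 0 := by
      simp [hS]
    have htop : S (a + 1) = 0 := by simp [hS, gaussBinom_eq_zero]
    rw [show a + 1 + m = a + (m + 1) by ring, show a + 1 + l = a + (l + 1) by ring,
      ← ih (m + 1) (l + 1), sum_congr rfl fun j _ => hr j, sum_range_succ',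
      sum_congr rfl fun j _ => hl j, h0, sum_add_distrib, sum_add_distrib, add_assoc,
      ← sum_range_succ' S, sum_range_succ S, htop, add_zero]

lemma qInt_succ (q : R) (n : ℕ) : qInt q (n + 1) = qInt q n + q ^ n := sum_range_succ _ _

@[simp] lemma qInt_zero (q : R) : qInt q 0 = 0 := rfl

@[simp] lemma qInt_one (q : R) : qInt q 1 = 1 := by simp [qInt]

lemma qInt_add (q : R) (m n : ℕ) : qInt q (m + n) = qInt q m + q ^ m * qInt q n := by
  simp only [qInt, sum_range_add, mul_sum, pow_add]

lemma qInt_mul (q : R) (r m : ℕ) : qInt q (r * m) = qInt q r * qInt (q ^ r) m := by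
  induction m with
  | zero => simp
  | succ m ih => rw [mul_add, mul_one, qInt_add, ih, qInt_succ, pow_mul]; ring

lemma qFactorial_succ (q : R) (n : ℕ) : qFactorial q (n + 1) = qFactorial q n * qInt q (n + 1) :=
  prod_Icc_succ_top (by omega) _

@[simp] lemma qFactorial_zero (q : R) : qFactorial q 0 = 1 := rfl

lemma gaussBinom_mul_qFactorial (q : R) (k j : ℕ) :
    gaussBinom q (k + j) k * (qFactorial q k * qFactorial q j) = qFactorial q (k + j) := by
  induction hs : k + j generalizing k j with
  | zero =>
    obtain ⟨rfl, rfl⟩ : k = 0 ∧ j = 0 := by omega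
    simp
  | succ s ih =>
    rcases k with _ | k
    · obtain rfl : j = s + 1 := by omega
      simp
    rcases j with _ | j
    · obtain rfl : k = s := by omega
      simp
    have h1 := ih k (j + 1) (by omega)
    have h2 := ih (k + 1) j (by omega)
    rw [gaussBinom_succ_succ, qFactorial_succ q s, ← hs, qInt_add q (k + 1) (j + 1)]
    rw [qFactorial_succ q j] at *
    rw [qFactorial_succ q k] at *
    linear_combination qInt q (k + 1) * h1 + q ^ (k + 1) * qInt q (j + 1) * h2

/-- The absorption rule `[k+1] (m choose k+1) = [m-k] (m choose k)`. -/
lemma gaussBinom_succ_mul_qInt (q : R) (k j : ℕ) :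
    gaussBinom q (k + j) (k + 1) * qInt q (k + 1) = gaussBinom q (k + j) k * qInt q j := by
  induction k generalizing j with
  | zero =>
    induction j with
    | zero => simp [gaussBinom_eq_zero]
    | succ j ih =>
      simp only [zero_add, gaussBinom_zero_right, qInt_one, mul_one, one_mul] at ih ⊢
      rw [gaussBinom_succ_succ, add_comm j 1, qInt_add, ih]
      simp
  | succ k ihk =>
    induction j with
    | zero => simp [gaussBinom_eq_zero]
    | succ j ihj =>
      have h1 := ihk (j + 1)
      rw [show k + 1 + (j + 1) = (k + 1 + j) + 1 by ring, gaussBinom_succ_succ,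
        gaussBinom_succ_succ]
      rw [show k + (j + 1) = k + 1 + j by ring] at h1
      have e1 : qInt q (k + 1 + 1) = 1 + q * qInt q (k + 1) := by
        rw [add_comm (k + 1) 1, qInt_add]; simp
      have e2 : qInt q (k + 1 + 1) = qInt q (k + 1) + q ^ (k + 1) := qInt_succ _ _
      have e3 : qInt q (j + 1) = 1 + q * qInt q j := by
        rw [add_comm j 1, qInt_add]; simp
      rw [e3] at h1 ⊢
      rw [add_mul, mul_assoc _ _ (qInt q (k + 1 + 1)), ihj, e2, pow_succ]
      linear_combination h1

lemma qBinomial_eq_gaussBinom {K : Type*} [Field K] {q : K} (hq : ∀ n, qInt q (n + 1) ≠ 0)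
    {n k : ℕ} (h : k ≤ n) : qBinomial q n k = gaussBinom q n k := by
  have hf : ∀ n, qFactorial q n ≠ 0 := fun n => by
    induction n with
    | zero => simp
    | succ n ih => rw [qFactorial_succ]; exact mul_ne_zero ih (hq n)
  obtain ⟨j, rfl⟩ := Nat.exists_eq_add_of_le h
  rw [qBinomial, Nat.add_sub_cancel_left, ← gaussBinom_mul_qFactorial q k j]
  exact mul_div_cancel_right₀ _ (mul_ne_zero (hf k) (hf j))

/-- The matrix of Gaussian binomial coefficients is unitriangular, so an expansion in it
determines the coefficients. -/
lemma eq_of_sum_gaussBinom_eq {q : R} {L L' : ℕ → R}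
    (h : ∀ m, ∑ k ∈ range (m + 1), L k * gaussBinom q m k
      = ∑ k ∈ range (m + 1), L' k * gaussBinom q m k) (k : ℕ) : L k = L' k := by
  induction k using Nat.strong_induction_on with
  | _ k ih =>
    have hk := h k
    rw [sum_range_succ, sum_range_succ,
      sum_congr rfl fun i hi => by rw [ih i (mem_range.1 hi)]] at hk
    simpa using hk

end GaussBinom

/-! ### Expansions of powers of `q`-integers -/

section Expansion

variable {R : Type*} [CommRing R]

lemma triangle_eq_zero (w : ℕ → R) {n k : ℕ} (h : n < k) : triangle w n k = 0 := by
  induction n generalizing k with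
  | zero => cases k with
    | zero => omega
    | succ k => rfl
  | succ n ih => cases k with
    | zero => omega
    | succ k => rw [triangle, ih (by omega), ih (by omega)]; simp

/-- The weights of the array are the nodes of a Newton expansion of `x ^ n`. -/
lemma pow_eq_sum_triangle (w : ℕ → R) (x : R) (n N : ℕ) (h : n < N) :
    x ^ n = ∑ k ∈ range N, triangle w n k * ∏ i ∈ range k, (x - w i) := by
  induction n generalizing N with
  | zero =>
    rw [sum_eq_single 0]
    · simp [triangle]
    · rintro (_ | k) _ hk
      · exact absurd rfl hk
      · simp [triangle]
    · intro h0; exact absurd (mem_range.2 h) h0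
  | succ n ih =>
    obtain ⟨N, rfl⟩ : ∃ M, N = M + 1 := ⟨N - 1, by omega⟩
    have key : ∀ k, triangle w n k * (∏ i ∈ range k, (x - w i)) * x
        = triangle w n k * ∏ i ∈ range (k + 1), (x - w i)
          + w k * triangle w n k * ∏ i ∈ range k, (x - w i) := fun k => by
      rw [prod_range_succ]; ring
    rw [pow_succ, ih (N + 1) (by omega), sum_mul, sum_congr rfl fun k _ => key k,
      sum_add_distrib, sum_range_succ, triangle_eq_zero w (show n < N by omega),
      sum_range_succ' _ N, sum_range_succ' _ N]
    simp only [triangle, add_mul, sum_add_distrib]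
    ring

/-- If `w m - w i` is a multiple `d i` of `[m-i]`, the Newton expansion of `(w m) ^ n` is an
expansion in Gaussian binomial coefficients. -/
lemma pow_eq_sum_gaussBinom (q : R) (w d : ℕ → R)
    (hw : ∀ i j, w (i + j) - w i = d i * qInt q j) (n m : ℕ) :
    w m ^ n = ∑ k ∈ range (m + 1),
      (∏ i ∈ range k, d i) * qFactorial q k * triangle w n k * gaussBinom q m k := by
  have hprod : ∀ k, ∏ i ∈ range k, (w m - w i)
      = (∏ i ∈ range k, d i) * qFactorial q k * gaussBinom q m k := fun k => by
    induction k with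
    | zero => simp
    | succ k ih =>
      rw [prod_range_succ, ih, prod_range_succ, qFactorial_succ]
      rcases le_or_gt k m with hk | hk
      · obtain ⟨j, rfl⟩ := Nat.exists_eq_add_of_le hk
        have h1 := gaussBinom_succ_mul_qInt q k j
        rw [hw]
        linear_combination -(∏ i ∈ range k, d i) * qFactorial q k * d k * h1
      · rw [gaussBinom_eq_zero q hk, gaussBinom_eq_zero q (by omega)]; simp
  rw [pow_eq_sum_triangle w (w m) n (n + 1 + (m + 1)) (by omega), ← sum_subset
    (range_subset_range.2 (show m + 1 ≤ n + 1 + (m + 1) by omega))]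
  · exact sum_congr rfl fun k _ => by rw [hprod]; ring
  · intro k _ hk
    rw [hprod, gaussBinom_eq_zero q (by simpa using hk)]; simp

/-- Passing from the `h`-vector `A` of a sequence `f` to its coefficients `L` in the basis of
Gaussian binomial coefficients: expand each `(n+m-l choose n)` by `q`-Vandermonde and
compare coefficients. -/
lemma coeff_eq_of_expansions (q : R) (n : ℕ) (A L f : ℕ → R) (hA : ∀ l, n < l → A l = 0)
    (h1 : ∀ m, f m = ∑ p ∈ antidiagonal m, A p.1 * gaussBinom q (n + p.2) n)
    (h2 : ∀ m, f m = ∑ k ∈ range (m + 1), L k * gaussBinom q m k) (k : ℕ) :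
    L k = ∑ l ∈ range (k + 1), q ^ (k * (k - l)) * A l * gaussBinom q (n - l) (k - l) := by
  refine eq_of_sum_gaussBinom_eq (q := q) (L' := fun k => ∑ l ∈ range (k + 1),
    q ^ (k * (k - l)) * A l * gaussBinom q (n - l) (k - l)) (fun m => ?_) k
  rw [← h2, h1, Nat.sum_antidiagonal_eq_sum_range_succ
    (fun l j => A l * gaussBinom q (n + j) n)]
  simp only [sum_mul]
  rw [sum_comm' (t' := range (m + 1)) (s' := fun l => Ico l (m + 1))
    (by intro x y; simp only [mem_range, mem_Ico]; omega)]
  refine sum_congr rfl fun l hl => ?_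
  have hl : l ≤ m := by simpa [Nat.lt_succ_iff] using hl
  rcases le_or_gt l n with hln | hln
  · obtain ⟨a, rfl⟩ := Nat.exists_eq_add_of_le' hln
    obtain ⟨b, rfl⟩ := Nat.exists_eq_add_of_le hl
    have hv := gaussBinom_vandermonde q a (l + b) l
    rw [show a + l + (l + b - l) = a + (l + b) by omega, ← hv, mul_sum, sum_Ico_eq_sum_range]
    simp only [Nat.add_sub_cancel_left, Nat.add_sub_cancel]
    have hmax : ∀ M, a ≤ M → ∑ j ∈ range (a + 1),
        A l * (q ^ ((l + j) * j) * gaussBinom q a j * gaussBinom q (l + b) (l + j))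
        = ∑ j ∈ range (M + 1),
        A l * (q ^ ((l + j) * j) * gaussBinom q a j * gaussBinom q (l + b) (l + j)) :=
      fun M hM => sum_subset (range_subset_range.2 (by omega)) fun j _ hj => by
        rw [gaussBinom_eq_zero q (show a < j by simpa using hj)]; simp
    have hmax' : ∀ M, b ≤ M → ∑ j ∈ range (b + 1),
        A l * (q ^ ((l + j) * j) * gaussBinom q a j * gaussBinom q (l + b) (l + j))
        = ∑ j ∈ range (M + 1),
        A l * (q ^ ((l + j) * j) * gaussBinom q a j * gaussBinom q (l + b) (l + j)) :=
      fun M hM => sum_subset (range_subset_range.2 (by omega)) fun j _ hj => by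
        rw [gaussBinom_eq_zero q (show l + b < l + j by simp at hj; omega)]; simp
    rw [hmax (a + b) (by omega), ← hmax' (a + b) (by omega), show l + b + 1 - l = b + 1 by omega]
    exact sum_congr rfl fun j _ => by ring
  · simp [hA l hln]

end Expansion

/-! ### Appending a letter to a colored permutation -/

section Append

variable {r n : ℕ}

/-- The permutation of `n + 1` letters that ends in `y` and whose first `n` letters are in the
relative order of `τ`. -/
def snocPerm (y : Fin (n + 1)) (τ : Equiv.Perm (Fin n)) : Equiv.Perm (Fin (n + 1)) :=
  (finSuccEquiv' (Fin.last n)).trans ((Equiv.optionCongr τ).trans (finSuccEquiv' y).symm)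

@[simp] lemma snocPerm_last (y : Fin (n + 1)) (τ : Equiv.Perm (Fin n)) :
    snocPerm y τ (Fin.last n) = y := by
  simp [snocPerm]

@[simp] lemma snocPerm_castSucc (y : Fin (n + 1)) (τ : Equiv.Perm (Fin n)) (i : Fin n) :
    snocPerm y τ i.castSucc = y.succAbove (τ i) := by
  have h := finSuccEquiv'_succAbove (Fin.last n) i
  rw [Fin.succAbove_last] at h
  simp [snocPerm, h]

/-- Append the letter `y` with color `c`, standardizing the earlier letters. -/
def snoc (π : ColoredPerm r n) (x : Fin (n + 1) × Fin r) : ColoredPerm r (n + 1) :=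
  (snocPerm x.1 π.1, Fin.snoc (α := fun _ => Fin r) π.2 x.2)

lemma snoc_bijective :
    Function.Bijective fun p : ColoredPerm r n × (Fin (n + 1) × Fin r) => snoc p.1 p.2 := by
  rw [Fintype.bijective_iff_injective_and_card]
  constructor
  · rintro ⟨⟨τ, z⟩, y, c⟩ ⟨⟨τ', z'⟩, y', c'⟩ h
    have h1 : snocPerm y τ = snocPerm y' τ' := congrArg Prod.fst h
    have h2 : (Fin.snoc z c : Fin (n + 1) → Fin r) = Fin.snoc z' c' := congrArg Prod.snd h
    obtain rfl : y = y' := by simpa using DFunLike.congr_fun h1 (Fin.last n)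
    obtain rfl : c = c' := by simpa using congrFun h2 (Fin.last n)
    obtain rfl : z = z' := funext fun i => by simpa using congrFun h2 i.castSucc
    obtain rfl : τ = τ' := Equiv.ext fun i => by simpa using DFunLike.congr_fun h1 i.castSucc
    rfl
  · simp only [Fintype.card_prod, Fintype.card_perm, Fintype.card_fin, Fintype.card_fun,
      Nat.factorial_succ, pow_succ]
    ring

lemma letter_succ (π : Equiv.Perm (Fin n)) {i : ℕ} (h : i < n) :
    letter π (i + 1) = (π ⟨i, h⟩ : ℕ) + 1 := by simp [letter, h]

lemma color_succ (z : Fin n → Fin r) {i : ℕ} (h : i < n) :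
    color z (i + 1) = (z ⟨i, h⟩ : ℕ) := by simp [color, h]

lemma letter_snocPerm (y : Fin (n + 1)) (τ : Equiv.Perm (Fin n)) {i : ℕ} (h : i ≤ n) :
    letter (snocPerm y τ) i = if letter τ i ≤ y then letter τ i else letter τ i + 1 := by
  rcases i with _ | i
  · simp [letter]
  have hi : i < n := h
  have h1 : snocPerm y τ ⟨i, by omega⟩ = y.succAbove (τ ⟨i, hi⟩) := snocPerm_castSucc y τ ⟨i, hi⟩
  rw [letter_succ _ (show i < n + 1 by omega), letter_succ τ hi, h1, Fin.succAbove]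
  simp only [Fin.lt_def, Fin.val_castSucc]
  split_ifs <;> simp_all; omega

lemma letter_snocPerm_last (y : Fin (n + 1)) (τ : Equiv.Perm (Fin n)) :
    letter (snocPerm y τ) (n + 1) = y + 1 := by
  rw [letter_succ _ (show n < n + 1 by omega)]
  exact congrArg (fun x : Fin (n + 1) => (x : ℕ) + 1) (snocPerm_last y τ)

lemma color_snoc (z : Fin n → Fin r) (c : Fin r) {i : ℕ} (h : i ≤ n) :
    color (Fin.snoc z c : Fin (n + 1) → Fin r) i = color z i := by
  rcases i with _ | i
  · rfl
  have hi : i < n := h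
  rw [color_succ _ (show i < n + 1 by omega), color_succ z hi]
  exact congrArg Fin.val (Fin.snoc_castSucc (α := fun _ => Fin r) c z ⟨i, hi⟩)

lemma color_snoc_last (z : Fin n → Fin r) (c : Fin r) :
    color (Fin.snoc z c : Fin (n + 1) → Fin r) (n + 1) = c := by
  rw [color_succ _ (show n < n + 1 by omega)]
  exact congrArg Fin.val (Fin.snoc_last (α := fun _ => Fin r) c z)

lemma rank_lt_rank (m c m' c' : ℕ) : rank m c < rank m' c' ↔
    if c = 0 then c' = 0 ∧ m < m'
    else if c' = 0 then 0 < m ∨ 0 < m' ∨ 0 < c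
    else m' < m ∨ m = m' ∧ c' < c := by
  unfold rank
  split_ifs <;> simp only [Prod.Lex.toLex_lt_toLex] <;> omega

/-- Standardization does not change the comparisons between colored letters. -/
lemma rank_bump_lt_rank_bump (y m c m' c' : ℕ) :
    rank (if m ≤ y then m else m + 1) c < rank (if m' ≤ y then m' else m' + 1) c'
      ↔ rank m c < rank m' c' := by
  simp only [rank_lt_rank]
  split_ifs <;> omega

/-- The comparison at the last descent position: whether appending `x` to `π` creates a descent
at `n`. -/
def lastDescent (π : ColoredPerm r n) (x : Fin (n + 1) × Fin r) : Prop :=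
  if (x.2 : ℕ) = 0 then color π.2 n = 0 ∧ x.1 < letter π.1 n
  else color π.2 n = 0 ∨ letter π.1 n ≤ x.1

instance (π : ColoredPerm r n) (x : Fin (n + 1) × Fin r) : Decidable (lastDescent π x) := by
  unfold lastDescent; infer_instance

lemma desR_snoc (π : ColoredPerm r n) (x : Fin (n + 1) × Fin r) :
    desR (snoc π x) = if lastDescent π x then insert n (desR π) else desR π := by
  ext i
  have hlt : i < n → (coloredLetter (snoc π x) (i + 1) < coloredLetter (snoc π x) i
      ↔ coloredLetter π (i + 1) < coloredLetter π i) := fun hi => by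
    simp only [coloredLetter, snoc]
    rw [letter_snocPerm _ _ hi.le, letter_snocPerm _ _ (show i + 1 ≤ n from hi),
      color_snoc _ _ hi.le, color_snoc _ _ (show i + 1 ≤ n from hi), rank_bump_lt_rank_bump]
  have hlast : coloredLetter (snoc π x) (n + 1) < coloredLetter (snoc π x) n
      ↔ lastDescent π x := by
    simp only [coloredLetter, snoc, lastDescent]
    rw [letter_snocPerm _ _ le_rfl, letter_snocPerm_last, color_snoc _ _ le_rfl,
      color_snoc_last, rank_lt_rank]
    split_ifs <;> omega
  simp only [desR, mem_filter, mem_range, gt_iff_lt]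
  rcases lt_trichotomy i n with hi | rfl | hi
  · rw [hlt hi]
    split_ifs <;> simp [hi, hi.ne, Nat.lt_succ_of_lt hi]
  · rw [hlast]
    split_ifs with h <;> simp [h]
  · split_ifs <;> simp <;> omega

lemma notMem_desR (π : ColoredPerm r n) : n ∉ desR π := by simp [desR]

lemma card_desR_snoc (π : ColoredPerm r n) (x : Fin (n + 1) × Fin r) :
    #(desR (snoc π x)) = #(desR π) + if lastDescent π x then 1 else 0 := by
  rw [desR_snoc]
  split_ifs
  · rw [card_insert_of_notMem (notMem_desR π)]
  · rfl

lemma fmajR_snoc (π : ColoredPerm r n) (x : Fin (n + 1) × Fin r) :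
    fmajR (snoc π x) = fmajR π + x.2 + if lastDescent π x then r * n else 0 := by
  have hz : ∑ i, ((snoc π x).2 i : ℕ) = ∑ i, (π.2 i : ℕ) + x.2 := by
    rw [Fin.sum_univ_castSucc]; simp [snoc]
  rw [fmajR, fmajR, hz, desR_snoc]
  split_ifs
  · rw [sum_insert (notMem_desR π)]; ring
  · ring

/-- After a letter has been appended, whether the next one creates a descent depends only on
these two letters. -/
lemma lastDescent_snoc (π : ColoredPerm r n) (p : Fin (n + 1) × Fin r)
    (x : Fin (n + 1 + 1) × Fin r) : lastDescent (snoc π p) x ↔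
      if (x.2 : ℕ) = 0 then (p.2 : ℕ) = 0 ∧ (x.1 : ℕ) ≤ p.1
      else (p.2 : ℕ) = 0 ∨ (p.1 : ℕ) < x.1 := by
  simp only [lastDescent, snoc, color_snoc_last, letter_snocPerm_last]
  split_ifs <;> omega

end Append

/-! ### The Carlitz identity for colored permutations -/

section Carlitz

open PowerSeries

variable {R : Type*} [CommRing R]

/-- The contribution `q ^ fmaj(π) t ^ des(π)` of a colored permutation. -/
noncomputable def weight (q : R) {r n : ℕ} (π : ColoredPerm r n) : R⟦X⟧ :=
  C (q ^ fmajR π) * X ^ #(desR π)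

/-- `∑_π q ^ fmaj(π) t ^ des(π)` over the colored permutations `π` of `n` letters. -/
noncomputable def genSeries (q : R) (r n : ℕ) : R⟦X⟧ := ∑ π : ColoredPerm r n, weight q π

/-- The part of `genSeries q r (n + 1)` that comes from the words with last letter `x`. -/
noncomputable def lastSeries (q : R) (r n : ℕ) (x : Fin (n + 1) × Fin r) : R⟦X⟧ :=
  ∑ π : ColoredPerm r n, weight q (snoc π x)

lemma coeff_genSeries (q : R) (r n l : ℕ) : coeff l (genSeries q r n) = eulerianR q r n l := by
  simp only [genSeries, weight, map_sum, coeff_C_mul, coeff_X_pow, eulerianR, sum_filter,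
    mul_ite, mul_one, mul_zero, eq_comm]

lemma weight_snoc (q : R) {r n : ℕ} (π : ColoredPerm r n) (x : Fin (n + 1) × Fin r) :
    weight q (snoc π x)
      = C (q ^ (x.2 : ℕ)) * (if lastDescent π x then C (q ^ (r * n)) * X else 1) * weight q π := by
  rw [weight, weight, card_desR_snoc, fmajR_snoc]
  split_ifs <;> simp only [pow_add, map_mul, add_zero, pow_one, mul_one] <;> ring

lemma sum_snoc {M : Type*} [AddCommMonoid M] {r n : ℕ} (f : ColoredPerm r (n + 1) → M) :
    ∑ π, f π = ∑ x : Fin (n + 1) × Fin r, ∑ π : ColoredPerm r n, f (snoc π x) := by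
  rw [← (Equiv.ofBijective _ (snoc_bijective (r := r) (n := n))).sum_comp f,
    Fintype.sum_prod_type_right]
  rfl

lemma genSeries_succ (q : R) (r n : ℕ) :
    genSeries q r (n + 1) = ∑ x, lastSeries q r n x := sum_snoc _

lemma lastSeries_succ (q : R) (r n : ℕ) (x : Fin (n + 1 + 1) × Fin r) :
    lastSeries q r (n + 1) x = C (q ^ (x.2 : ℕ)) * ∑ p : Fin (n + 1) × Fin r,
      (if (if (x.2 : ℕ) = 0 then (p.2 : ℕ) = 0 ∧ (x.1 : ℕ) ≤ p.1
        else (p.2 : ℕ) = 0 ∨ (p.1 : ℕ) < x.1) then C (q ^ (r * (n + 1))) * X else 1)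
        * lastSeries q r n p := by
  rw [lastSeries, sum_snoc, mul_sum]
  refine sum_congr rfl fun p _ => ?_
  rw [lastSeries, mul_sum, mul_sum]
  refine sum_congr rfl fun π _ => ?_
  rw [weight_snoc q (snoc π p) x]
  simp only [lastDescent_snoc, mul_assoc]

end Carlitz

section ClosedForm

open PowerSeries

variable {R : Type*} [CommRing R]

lemma sum_ite_mk (N : ℕ) (P : ℕ → Prop) [DecidablePred P] (f : ℕ → ℕ → R) :
    ∑ p ∈ range N, (if P p then mk (f p) else 0)
      = PowerSeries.mk fun k => ∑ p ∈ range N, if P p then f p k else 0 := by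
  ext k
  rw [map_sum, coeff_mk]
  refine sum_congr rfl fun p _ => ?_
  split_ifs <;> simp

/-- The lower part of the geometric sum `∑ x ^ p z ^ (n - p)`. -/
lemma geom_sum_lt (x z : R) (n y d : ℕ) (h : y + d = n + 1) :
    (x - z) * ∑ p ∈ range (n + 1), (if p < y then x ^ p * z ^ (n - p) else 0)
      = z ^ d * (x ^ y - z ^ y) := by
  rw [← geom_sum₂_mul, ← sum_filter, show (range (n + 1)).filter (· < y) = range y by
    ext i; simp only [mem_filter, mem_range]; omega]
  rw [mul_sum, sum_mul, mul_sum]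
  refine sum_congr rfl fun p hp => ?_
  have hp : p < y := by simpa using hp
  rw [show n - p = (y - 1 - p) + d by omega, pow_add]; ring

/-- The upper part of the geometric sum `∑ x ^ p z ^ (n - p)`. -/
lemma geom_sum_ge (x z : R) (n y d : ℕ) (h : y + d = n + 1) :
    (x - z) * ∑ p ∈ range (n + 1), (if y ≤ p then x ^ p * z ^ (n - p) else 0)
      = x ^ y * (x ^ d - z ^ d) := by
  have h1 := geom_sum_lt x z n y d h
  have h2 : (x - z) * ∑ p ∈ range (n + 1), x ^ p * z ^ (n - p) = x ^ (n + 1) - z ^ (n + 1) := by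
    rw [← geom_sum₂_mul, mul_comm]; simp
  have h3 : ∑ p ∈ range (n + 1), x ^ p * z ^ (n - p)
      = ∑ p ∈ range (n + 1), (if p < y then x ^ p * z ^ (n - p) else 0)
        + ∑ p ∈ range (n + 1), (if y ≤ p then x ^ p * z ^ (n - p) else 0) := by
    rw [← sum_add_distrib]
    refine sum_congr rfl fun p _ => ?_
    split_ifs <;> first | omega | simp
  rw [h3, mul_add, h1, ← h, pow_add, pow_add, h] at h2
  linear_combination h2

/-- The series of the words ending in the uncolored letter `y + 1`, up to the common factor
`∏ (1 - q ^ (r i) t)`. With `a k = [rk+1]` and `b k = q [rk]`, its coefficient at `t ^ k` counts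
by their sum the vectors with entries in `{0, …, rk}` at the `y` places before the letter and in
`{1, …, rk}` at the `n - y` places after it. -/
noncomputable def plainSeries (a b : ℕ → R) (n y : ℕ) : R⟦X⟧ :=
  PowerSeries.mk fun k => a k ^ y * b k ^ (n - y)

/-- The series of the words ending in the letter `y + 1` with a nonzero color, up to
the common factor `∏ (1 - q ^ (r i) t)` and the power of `q` for that color. -/
noncomputable def coloredSeries (Q : R) (a b : ℕ → R) (n y : ℕ) : R⟦X⟧ :=
  X * PowerSeries.mk fun k => (Q * a k) ^ y * b (k + 1) ^ (n - y)

variable {Q s : R} {a b : ℕ → R}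

lemma sum_plain_lt (hab : ∀ k, a k - b k = 1) {n y d : ℕ} (h : y + d = n + 1) :
    ∑ p ∈ range (n + 1), (if p < y then plainSeries a b n p else 0)
      = PowerSeries.mk fun k => b k ^ d * (a k ^ y - b k ^ y) := by
  simp only [plainSeries]
  rw [sum_ite_mk]
  congr 1; funext k
  rw [← geom_sum_lt _ _ n y d h, hab, one_mul]

lemma sum_plain_ge (hab : ∀ k, a k - b k = 1) {n y d : ℕ} (h : y + d = n + 1) :
    ∑ p ∈ range (n + 1), (if y ≤ p then plainSeries a b n p else 0)
      = PowerSeries.mk fun k => a k ^ y * (a k ^ d - b k ^ d) := by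
  simp only [plainSeries]
  rw [sum_ite_mk]
  congr 1; funext k
  rw [← geom_sum_ge _ _ n y d h, hab, one_mul]

lemma sum_colored_lt (hQ : ∀ k, b (k + 1) - Q * a k = s) {n y d : ℕ} (h : y + d = n + 1) :
    C s * ∑ p ∈ range (n + 1), (if p < y then coloredSeries Q a b n p else 0)
      = X * PowerSeries.mk fun k => b (k + 1) ^ d * (b (k + 1) ^ y - (Q * a k) ^ y) := by
  simp only [coloredSeries, ← mul_ite_zero]
  rw [← mul_sum, sum_ite_mk, mul_left_comm]
  congr 1; ext k
  rw [coeff_C_mul, coeff_mk, coeff_mk, ← hQ k]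
  linear_combination -geom_sum_lt (Q * a k) (b (k + 1)) n y d h

lemma sum_colored_ge (hQ : ∀ k, b (k + 1) - Q * a k = s) {n y d : ℕ} (h : y + d = n + 1) :
    C s * ∑ p ∈ range (n + 1), (if y ≤ p then coloredSeries Q a b n p else 0)
      = X * PowerSeries.mk fun k => (Q * a k) ^ y * (b (k + 1) ^ d - (Q * a k) ^ d) := by
  simp only [coloredSeries, ← mul_ite_zero]
  rw [← mul_sum, sum_ite_mk, mul_left_comm]
  congr 1; ext k
  rw [coeff_C_mul, coeff_mk, coeff_mk, ← hQ k]
  linear_combination -geom_sum_ge (Q * a k) (b (k + 1)) n y d h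

lemma sum_plain (hab : ∀ k, a k - b k = 1) (n : ℕ) :
    ∑ p ∈ range (n + 1), plainSeries a b n p = PowerSeries.mk fun k => a k ^ (n + 1) - b k ^ (n + 1) := by
  have h := sum_plain_ge hab (n := n) (y := 0) (d := n + 1) (by omega)
  simpa using h

lemma sum_colored (hQ : ∀ k, b (k + 1) - Q * a k = s) (n : ℕ) :
    C s * ∑ p ∈ range (n + 1), coloredSeries Q a b n p
      = X * PowerSeries.mk fun k => b (k + 1) ^ (n + 1) - (Q * a k) ^ (n + 1) := by
  have h := sum_colored_ge hQ (n := n) (y := 0) (d := n + 1) (by omega)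
  simpa using h

/-- The recursion for an uncolored last letter: a descent precedes it exactly when the previous
letter is uncolored and larger. -/
lemma plainSeries_succ (hab : ∀ k, a k - b k = 1) (hQ : ∀ k, b (k + 1) - Q * a k = s)
    (hb : b 0 = 0) {n y : ℕ} (hy : y ≤ n + 1) :
    (1 - C (Q ^ (n + 1)) * X) * plainSeries a b (n + 1) y
      = C s * ∑ p ∈ range (n + 1), coloredSeries Q a b n p
        + ∑ p ∈ range (n + 1), (if p < y then plainSeries a b n p else 0)
        + C (Q ^ (n + 1)) * X
          * ∑ p ∈ range (n + 1), (if y ≤ p then plainSeries a b n p else 0) := by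
  obtain ⟨d, hd⟩ := Nat.exists_eq_add_of_le hy
  rw [sum_colored hQ, sum_plain_lt hab hd.symm, sum_plain_ge hab hd.symm, plainSeries,
    show n + 1 - y = d by omega, hd]
  ext k
  rcases k with _ | k
  · simp [sub_mul, mul_assoc, coeff_zero_eq_constantCoeff, hb]
    simp [mul_sub, ← pow_add, add_comm d y, ← hd]
    ring
  · simp only [sub_mul, one_mul, mul_assoc, map_sub, map_add, coeff_mk, coeff_C_mul,
      coeff_succ_X_mul]
    ring

/-- The recursion for a colored last letter: a descent precedes it exactly when the previous
letter is uncolored, or colored and of smaller absolute value. -/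
lemma coloredSeries_succ (hab : ∀ k, a k - b k = 1) (hQ : ∀ k, b (k + 1) - Q * a k = s)
    (hb : b 0 = 0) {n y : ℕ} (hy : y ≤ n + 1) :
    (1 - C (Q ^ (n + 1)) * X) * coloredSeries Q a b (n + 1) y
      = C (Q ^ (n + 1)) * X * ∑ p ∈ range (n + 1), plainSeries a b n p
        + C (Q ^ (n + 1)) * X
          * (C s * ∑ p ∈ range (n + 1), (if p < y then coloredSeries Q a b n p else 0))
        + C s * ∑ p ∈ range (n + 1), (if y ≤ p then coloredSeries Q a b n p else 0) := by
  obtain ⟨d, hd⟩ := Nat.exists_eq_add_of_le hy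
  rw [sum_plain hab, sum_colored_lt hQ hd.symm, sum_colored_ge hQ hd.symm, coloredSeries,
    show n + 1 - y = d by omega, hd]
  ext k
  rcases k with _ | k
  · simp [sub_mul, mul_assoc]
  simp only [sub_mul, one_mul, mul_assoc, map_sub, map_add, coeff_mk, coeff_C_mul,
      coeff_succ_X_mul]
  rcases k with _ | k
  · have h0 : (0 : R) ^ y * 0 ^ d = 0 := by rw [← pow_add, ← hd]; simp
    simp [hb]
    linear_combination Q ^ (y + d) * h0
  · simp only [coeff_mk, coeff_succ_X_mul]
    ring

end ClosedForm

section Carlitz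

open PowerSeries

variable {R : Type*} [CommRing R] (q : R) (s : ℕ)

/-- `[rk+1]` for `r = s + 1`. -/
abbrev node (k : ℕ) : R := qInt q ((s + 1) * k + 1)

/-- `q [rk] = [rk+1] - 1` for `r = s + 1`. -/
abbrev nodePred (k : ℕ) : R := q * qInt q ((s + 1) * k)

lemma node_sub_nodePred (k : ℕ) : node q s k - nodePred q s k = 1 := by
  rw [node, nodePred, add_comm, qInt_add]; simp

lemma nodePred_succ_sub (k : ℕ) :
    nodePred q s (k + 1) - q ^ (s + 1) * node q s k = q * qInt q s := by
  rw [node, nodePred, show (s + 1) * (k + 1) = s + ((s + 1) * k + 1) by ring, qInt_add]; ring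

lemma nodePred_zero : nodePred q s 0 = 0 := by simp [nodePred]

/-- The product `∏_{i < N} (1 - q ^ i t)`. -/
noncomputable def denom {R : Type*} [CommRing R] (q : R) (N : ℕ) : R⟦X⟧ :=
  ∏ i ∈ range N, (1 - C (q ^ i) * X)

lemma sum_pow_succ : ∑ c : Fin s, q ^ ((c : ℕ) + 1) = q * qInt q s := by
  rw [Fin.sum_univ_eq_sum_range (fun c => q ^ (c + 1)), qInt, mul_sum]
  exact sum_congr rfl fun c _ => pow_succ' _ _

lemma lastSeries_zero (x : Fin 1 × Fin (s + 1)) :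
    lastSeries q (s + 1) 0 x = if x.2 = 0 then 1 else C (q ^ (x.2 : ℕ)) * X := by
  have h1 : ∀ π : ColoredPerm (s + 1) 0, weight q π = 1 := fun π => by
    have : desR π = ∅ := rfl
    simp [weight, fmajR, this]
  simp only [lastSeries, weight_snoc, h1, lastDescent, letter, color, Fin.val_eq_zero_iff]
  split_ifs with h h' h' <;> simp_all

/-- The closed form of the generating function refined by the last letter. It is preserved by the
recursion `lastSeries_succ` because the sums over the previous letter are geometric. -/
lemma lastSeries_eq (n : ℕ) (y : Fin (n + 1)) :
    lastSeries q (s + 1) n (y, 0)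
        = denom (q ^ (s + 1)) (n + 1) * plainSeries (node q s) (nodePred q s) n y
    ∧ ∀ c : Fin s, lastSeries q (s + 1) n (y, c.succ)
        = C (q ^ ((c : ℕ) + 1)) * (denom (q ^ (s + 1)) (n + 1)
          * coloredSeries (q ^ (s + 1)) (node q s) (nodePred q s) n y) := by
  induction n with
  | zero =>
    have hy : (y : ℕ) = 0 := by omega
    have hd : denom (q ^ (s + 1)) (0 + 1) * PowerSeries.mk (fun _ => (1 : R)) = 1 := by
      rw [denom, zero_add, prod_range_one, pow_zero, map_one, one_mul, mul_comm]
      exact mk_one_mul_one_sub_eq_one R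
    simp only [lastSeries_zero, plainSeries, coloredSeries, hy, Nat.sub_zero, pow_zero, one_mul]
    rw [mul_left_comm, hd]
    exact ⟨by simp, fun c => by simp⟩
  | succ n ih =>
    have hy : (y : ℕ) ≤ n + 1 := by omega
    have hplain := plainSeries_succ (node_sub_nodePred q s) (nodePred_succ_sub q s)
      (nodePred_zero q s) hy
    have hcol := coloredSeries_succ (node_sub_nodePred q s) (nodePred_succ_sub q s)
      (nodePred_zero q s) hy
    have hden : denom (q ^ (s + 1)) (n + 1 + 1)
        = denom (q ^ (s + 1)) (n + 1) * (1 - C ((q ^ (s + 1)) ^ (n + 1)) * X) :=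
      prod_range_succ _ _
    have hC : C (q * qInt q s) = ∑ c : Fin s, C (q ^ ((c : ℕ) + 1)) := by
      rw [← map_sum, sum_pow_succ]
    simp only [sum_range] at hplain hcol
    simp only [lastSeries_succ, Fintype.sum_prod_type, Fin.sum_univ_succ (n := s), (ih _).1,
      (ih _).2, pow_mul]
    rw [hden, mul_assoc, mul_assoc, hplain, hcol, hC]
    simp only [Fin.val_zero, Fin.val_succ, pow_zero, map_one, one_mul, Nat.add_eq_zero_iff,
      one_ne_zero, and_false, if_true, if_false, true_and, false_and, true_or, false_or]
    refine ⟨?_, fun c => ?_⟩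
    · simp only [← sum_mul, ← hC]
      simp only [mul_add, mul_sum, ← sum_add_distrib]
      refine sum_congr rfl fun p _ => ?_
      split_ifs <;> first | omega | ring
    · congr 1
      simp only [← mul_sum, ← sum_mul, ← hC]
      simp only [mul_add, mul_sum, ← sum_add_distrib]
      refine sum_congr rfl fun p _ => ?_
      split_ifs <;> first | omega | ring

/-- The Carlitz identity
`∑_π q ^ fmaj(π) t ^ des(π) = ∏_{i ≤ n} (1 - q ^ (r i) t) ∑_k [rk+1] ^ n t ^ k`, `r = s + 1`. -/
lemma genSeries_eq (n : ℕ) :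
    genSeries q (s + 1) n
      = denom (q ^ (s + 1)) (n + 1) * PowerSeries.mk fun k => node q s k ^ n := by
  rcases n with _ | n
  · have h1 : ∀ π : ColoredPerm (s + 1) 0, weight q π = 1 := fun π => by
      have : desR π = ∅ := rfl
      simp [weight, fmajR, this]
    rw [denom, zero_add, prod_range_one, pow_zero, map_one, one_mul, mul_comm]
    simp only [genSeries, h1, pow_zero]
    refine Eq.trans ?_ (mk_one_mul_one_sub_eq_one R).symm
    simp
  · have hden : denom (q ^ (s + 1)) (n + 1 + 1)
        = denom (q ^ (s + 1)) (n + 1) * (1 - C ((q ^ (s + 1)) ^ (n + 1)) * X) :=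
      prod_range_succ _ _
    have hC : C (q * qInt q s) = ∑ c : Fin s, C (q ^ ((c : ℕ) + 1)) := by
      rw [← map_sum, sum_pow_succ]
    have hp := sum_plain (node_sub_nodePred q s) n
    have hc := sum_colored (nodePred_succ_sub q s) n
    rw [sum_range] at hp hc
    rw [genSeries_succ, Fintype.sum_prod_type]
    simp only [Fin.sum_univ_succ (n := s), (lastSeries_eq q s n _).1, (lastSeries_eq q s n _).2]
    simp only [← sum_mul, ← hC, sum_add_distrib, ← mul_sum]
    rw [mul_left_comm, hc, hp, hden, mul_assoc, ← mul_add]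
    congr 1
    ext k
    rcases k with _ | k
    · simp [sub_mul, mul_assoc, nodePred_zero]
    · simp only [sub_mul, one_mul, mul_assoc, map_sub, map_add, coeff_mk, coeff_C_mul,
        coeff_succ_X_mul]
      ring

/-- The `q`-binomial series `∑_k (n+k choose n) t ^ k` is the inverse of
`∏_{i ≤ n} (1 - q ^ i t)`. -/
lemma denom_mul_mk_gaussBinom (n : ℕ) :
    denom q (n + 1) * PowerSeries.mk (fun k => gaussBinom q (n + k) n) = 1 := by
  induction n with
  | zero =>
    rw [denom, zero_add, prod_range_one, pow_zero, map_one, one_mul, mul_comm]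
    simp only [gaussBinom_zero_right]
    exact mk_one_mul_one_sub_eq_one R
  | succ n ih =>
    rw [denom, prod_range_succ, mul_assoc]
    refine Eq.trans ?_ ih
    rw [denom]
    congr 1
    ext k
    rcases k with _ | k
    · simp [sub_mul, mul_assoc, gaussBinom_self]
    · simp only [sub_mul, one_mul, mul_assoc, map_sub, coeff_mk, coeff_C_mul, coeff_succ_X_mul]
      rw [show n + 1 + (k + 1) = n + (k + 1) + 1 by ring, gaussBinom_succ_succ,
        show n + (k + 1) = n + 1 + k by ring]
      ring

/-- The `q`-Worpitzky identity, the coefficient form of `genSeries_eq`. -/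
lemma node_pow_eq_sum (n m : ℕ) : node q s m ^ n = ∑ p ∈ antidiagonal m,
    eulerianR q (s + 1) n p.1 * gaussBinom (q ^ (s + 1)) (n + p.2) n := by
  have h : genSeries q (s + 1) n
      * PowerSeries.mk (fun k => gaussBinom (q ^ (s + 1)) (n + k) n)
      = PowerSeries.mk fun k => node q s k ^ n := by
    rw [genSeries_eq, mul_right_comm, denom_mul_mk_gaussBinom, one_mul]
  have h2 := congrArg (coeff m) h
  rw [coeff_mul, coeff_mk] at h2
  simpa only [coeff_genSeries, coeff_mk] using h2.symm

lemma eulerianR_eq_zero {r n l : ℕ} (h : n < l) : eulerianR q r n l = 0 := by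
  refine sum_eq_zero fun π hπ => absurd ?_ h.not_ge
  rw [mem_filter] at hπ
  rw [← hπ.2]
  exact (card_filter_le _ _).trans (card_range n).le

end Carlitz

/-! ### Expansions in terms of Stirling numbers -/

section Stirling

variable {R : Type*} [CommRing R] (q : R)

/-- The identity for `r = s + 1`, in any commutative ring. -/
lemma stirlingR_eq_sum (s n k : ℕ) :
    q ^ ((s + 1) * k.choose 2 + k) * qInt q (s + 1) ^ k * qFactorial (q ^ (s + 1)) k
        * stirlingR q (s + 1) n k
      = ∑ l ∈ range (k + 1), (q ^ (s + 1)) ^ (k * (k - l)) * eulerianR q (s + 1) n l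
          * gaussBinom (q ^ (s + 1)) (n - l) (k - l) := by
  have h := coeff_eq_of_expansions (q ^ (s + 1)) n (eulerianR q (s + 1) n) _
    (fun m => node q s m ^ n) (fun l hl => eulerianR_eq_zero q hl) (node_pow_eq_sum q s n)
    (pow_eq_sum_gaussBinom (q ^ (s + 1)) (node q s)
      (fun i => q ^ ((s + 1) * i + 1) * qInt q (s + 1)) (fun i j => ?_) n) k
  · rw [← h]
    congr 2
    have hprod : ∏ i ∈ range k, (q ^ ((s + 1) * i + 1) * qInt q (s + 1))
        = q ^ ((s + 1) * k.choose 2 + k) * qInt q (s + 1) ^ k := by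
      rw [prod_mul_distrib, prod_const, card_range, prod_pow_eq_pow_sum, sum_add_distrib,
        ← mul_sum, sum_range_id, Nat.choose_two_right]
      simp
    rw [hprod]
  · rw [node, node, show (s + 1) * (i + j) + 1 = ((s + 1) * i + 1) + (s + 1) * j by ring,
      qInt_add q ((s + 1) * i + 1), qInt_mul]
    ring

lemma stirlingR_one (n k : ℕ) : stirlingR q 1 n k = stirlingA q (n + 1) (k + 1) := by
  have h0 : ∀ n, stirlingA q (n + 1) 0 = 0 := fun n => by simp [stirlingA, triangle]
  induction n generalizing k with
  | zero => cases k <;> simp [stirlingA, stirlingR, triangle]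
  | succ n ih =>
    rw [stirlingA, triangle, ← stirlingA, ← stirlingA, ← ih k]
    cases k with
    | zero => rw [h0]; simp [stirlingR, triangle]
    | succ k => rw [← ih k]; simp [stirlingR, triangle]

end Stirling

/-! ### Type A -/

section TypeA

lemma desR_one {n : ℕ} (π : ColoredPerm 1 n) : desR π = desA π.1 := by
  have hc : ∀ i, color π.2 i = 0 := fun i => by
    rcases i with _ | i
    · rfl
    · simp [color]
  ext i
  simp only [desR, desA, mem_filter, mem_range, mem_Ico, coloredLetter, hc, gt_iff_lt,
    rank_lt_rank, if_true, true_and]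
  rcases i with _ | i
  · simp [letter]
  · simp

lemma eulerianR_one {R : Type*} [CommRing R] (q : R) (n l : ℕ) :
    eulerianR q 1 n l = eulerianA q n l := by
  simp only [eulerianR, eulerianA, sum_filter]
  refine Fintype.sum_equiv (Equiv.prodUnique _ _) _ _ fun π => ?_
  simp [fmajR, maj, desR_one]
  rfl

lemma stirlingA_eq_sum {R : Type*} [CommRing R] (q : R) {n : ℕ} (hn : 1 ≤ n) (k : ℕ) :
    q ^ k.choose 2 * qFactorial q k * stirlingA q n k
      = ∑ l ∈ Icc 1 k, q ^ (k * (k - l)) * eulerianA q n (l - 1)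
          * gaussBinom q (n - l) (k - l) := by
  -- The polynomials `A_{n,l-1}` are the `h`-vector of `m ↦ [m] ^ n`: this is
  -- the identity for `[m + 1] ^ n`, shifted by one, which is possible as `[0] ^ n = 0`.
  set A : ℕ → R := fun l => if l = 0 then 0 else eulerianA q n (l - 1) with hAdef
  have htop : ∀ l, n ≤ l → eulerianA q n l = 0 := fun l hl => by
    refine sum_eq_zero fun π hπ => absurd (mem_filter.1 hπ).2 ?_
    have h1 := (card_filter_le (Ico 1 n) fun i => letter π i > letter π (i + 1))
    rw [Nat.card_Ico] at h1
    rw [desA]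
    omega
  have h := coeff_eq_of_expansions q n A _ (fun m => qInt q m ^ n) (fun l hl => ?_) (fun m => ?_)
    (pow_eq_sum_gaussBinom q (qInt q) (fun i => q ^ i) (fun i j => ?_) n) k
  · rw [prod_pow_eq_pow_sum, sum_range_id, ← Nat.choose_two_right] at h
    rw [stirlingA, h, range_eq_Ico, sum_eq_sum_Ico_succ_bot (by omega), Ico_add_one_right_eq_Icc]
    simp only [hAdef, if_true, mul_zero, zero_mul, zero_add]
    refine sum_congr rfl fun l hl => ?_
    rw [if_neg (by have := mem_Icc.1 hl; omega)]
  · simp only [hAdef]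
    split_ifs
    · rfl
    · exact htop _ (by omega)
  · rcases m with _ | m
    · simp [hAdef, show n ≠ 0 by omega]
    · have hm := node_pow_eq_sum q 0 n m
      rw [Nat.sum_antidiagonal_succ]
      simpa [hAdef, node, eulerianR_one] using hm
  · rw [qInt_add]; ring

end TypeA

/-! ### Type B -/

section TypeB

variable {n : ℕ}

/-- The element `i + 1` of `[±n]`. -/
def posElem (i : Fin n) : PlusMinus n :=
  ⟨(i : ℤ) + 1, by simp only [mem_erase, mem_Icc]; omega⟩

/-- The position in `Fin n` of the absolute value of an element of `[±n]`. -/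
def absIndex (j : PlusMinus n) : Fin n :=
  ⟨(j : ℤ).natAbs - 1, by
    have h := j.2
    simp only [mem_erase, mem_Icc] at h
    omega⟩

lemma natAbs_eq_absIndex (j : PlusMinus n) : (j : ℤ).natAbs = (absIndex j : ℕ) + 1 := by
  have h := j.2
  simp only [mem_erase, mem_Icc] at h
  simp only [absIndex]
  omega

lemma PlusMinus.ne_zero (j : PlusMinus n) : (j : ℤ) ≠ 0 := (mem_erase.1 j.2).1

/-- The negative of an element of `[±n]`. -/
def negElem (j : PlusMinus n) : PlusMinus n :=
  ⟨-(j : ℤ), by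
    have h := j.2
    simp only [mem_erase, mem_Icc] at h ⊢
    omega⟩

lemma SignedPerm.map_neg (π : SignedPerm n) (j : PlusMinus n) :
    (π.1 (negElem j) : ℤ) = -(π.1 j : ℤ) := π.2 j (negElem j) rfl

lemma eq_or_eq_negElem (i j : PlusMinus n) (h : absIndex i = absIndex j) :
    i = j ∨ i = negElem j := by
  have h1 := natAbs_eq_absIndex i
  rw [h, ← natAbs_eq_absIndex j, Int.natAbs_eq_natAbs_iff] at h1
  exact h1.imp Subtype.ext Subtype.ext

/-- The permutation of absolute values of a signed permutation, in one-line notation. -/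
noncomputable def SignedPerm.absPerm (π : SignedPerm n) : Equiv.Perm (Fin n) :=
  Equiv.ofBijective (fun i => absIndex (π.1 (posElem i))) <| by
    refine Finite.injective_iff_bijective.1 fun i j h => ?_
    rcases eq_or_eq_negElem _ _ h with h | h
    · have := congrArg Subtype.val (π.1.injective h)
      simp only [posElem] at this
      omega
    · have h' : π.1 (posElem i) = π.1 (negElem (posElem j)) := by
        rw [h]; exact Subtype.ext (π.map_neg _).symm
      have := congrArg Subtype.val (π.1.injective h')
      simp only [posElem, negElem] at this
      omega

/-- A signed permutation as a colored permutation: the color `1` marks the negative letters. -/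
noncomputable def SignedPerm.toColored (π : SignedPerm n) : ColoredPerm 2 n :=
  (π.absPerm, fun i => if (π.1 (posElem i) : ℤ) < 0 then 1 else 0)

/-- The signed value of a letter with color `0` or `1`. -/
def signed (m c : ℕ) : ℤ := if c = 0 then m else -m

lemma SignedPerm.coe_posElem (π : SignedPerm n) (i : Fin n) :
    (π.1 (posElem i) : ℤ) = signed ((π.toColored.1 i : ℕ) + 1) (π.toColored.2 i) := by
  have h1 := natAbs_eq_absIndex (π.1 (posElem i))
  have h2 : π.toColored.1 i = absIndex (π.1 (posElem i)) := rfl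
  rw [h2, ← h1]
  simp only [toColored, signed]
  split_ifs <;> simp_all <;> omega

lemma SignedPerm.letter_eq (π : SignedPerm n) {i : ℕ} (hi : i ≤ n) :
    SignedPerm.letter π (i : ℤ)
      = signed (QStirlingEulerian.letter π.toColored.1 i) (color π.toColored.2 i) := by
  rcases i with _ | i
  · simp [SignedPerm.letter, QStirlingEulerian.letter, signed, color]
  have hi : i < n := hi
  rw [letter_succ _ hi, color_succ _ hi, ← π.coe_posElem ⟨i, hi⟩, SignedPerm.letter, dif_pos
    (by simp only [mem_erase, mem_Icc]; omega)]
  rfl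

lemma SignedPerm.toColored_injective :
    Function.Injective (SignedPerm.toColored : SignedPerm n → ColoredPerm 2 n) := by
  intro π π' h
  have hpos : ∀ i, π.1 (posElem i) = π'.1 (posElem i) := fun i =>
    Subtype.ext (by rw [π.coe_posElem, π'.coe_posElem, h])
  refine Subtype.ext (Equiv.ext fun j => ?_)
  have hj : absIndex j = absIndex (posElem (absIndex j)) := by
    refine Fin.ext ?_
    have := natAbs_eq_absIndex (posElem (absIndex j))
    simp only [posElem] at this ⊢
    omega
  rcases eq_or_eq_negElem _ _ hj with h1 | h1
  · rw [h1]; exact hpos _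
  · rw [h1]; exact Subtype.ext (by rw [π.map_neg, π'.map_neg, hpos])

lemma SignedPerm.toColored_surjective :
    Function.Surjective (SignedPerm.toColored : SignedPerm n → ColoredPerm 2 n) := by
  rintro ⟨σ, z⟩
  have hmem : ∀ (m : Fin n) (c : ℕ), signed (m + 1) c ∈ (Icc (-(n : ℤ)) n).erase 0 := fun m c => by
    simp only [signed, mem_erase, mem_Icc]
    split_ifs <;> omega
  -- The odd extension of the map given on positive numbers by the signed letters.
  let g : PlusMinus n → ℤ := fun j =>
    (if (0 : ℤ) < j then 1 else -1) * signed (σ (absIndex j) + 1) (z (absIndex j))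
  have hg : ∀ j, g j ∈ (Icc (-(n : ℤ)) n).erase 0 := fun j => by
    have := hmem (σ (absIndex j)) (z (absIndex j))
    simp only [g, mem_erase, mem_Icc] at this ⊢
    split_ifs <;> omega
  let f : PlusMinus n → PlusMinus n := fun j => ⟨g j, hg j⟩
  have habs : ∀ j, absIndex (f j) = σ (absIndex j) := fun j => by
    have h1 := natAbs_eq_absIndex (f j)
    refine Fin.ext ?_
    simp only [f, g, signed] at h1 ⊢
    split_ifs at h1 ⊢ <;> omega
  have hidx : ∀ j : PlusMinus n, absIndex (negElem j) = absIndex j := fun j => by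
    refine Fin.ext ?_
    simp [absIndex, negElem]
  have hodd : ∀ j, g (negElem j) = -g j := fun j => by
    have := j.ne_zero
    simp only [g, hidx]
    have hneg : (negElem j : ℤ) = -j := rfl
    rw [hneg]
    rcases lt_or_gt_of_ne this with h | h
    · rw [if_pos (show 0 < -(j : ℤ) by omega), if_neg (show ¬0 < (j : ℤ) by omega)]; ring
    · rw [if_neg (show ¬0 < -(j : ℤ) by omega), if_pos (show 0 < (j : ℤ) from h)]; ring
  have hf : Function.Injective f := fun i j h => by
    have h1 : absIndex i = absIndex j := σ.injective (by rw [← habs, ← habs, h])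
    rcases eq_or_eq_negElem _ _ h1 with h2 | h2
    · exact h2
    · exfalso
      have h3 : g i = g j := congrArg Subtype.val h
      rw [h2, hodd] at h3
      exact (f j).ne_zero (show g j = 0 by omega)
  let π : SignedPerm n := ⟨Equiv.ofBijective f (Finite.injective_iff_bijective.1 hf), fun i j h => by
    obtain rfl : j = negElem i := Subtype.ext h
    exact hodd i⟩
  have hidx' : ∀ i : Fin n, absIndex (posElem i) = i := fun i => by
    refine Fin.ext ?_
    simp only [absIndex, posElem]
    omega
  have hval : ∀ i : Fin n, (π.1 (posElem i) : ℤ) = signed (σ i + 1) (z i) := fun i => by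
    have h1 : (π.1 (posElem i) : ℤ) = g (posElem i) := rfl
    rw [h1]
    simp only [g, hidx']
    rw [if_pos (by simp only [posElem]; omega), one_mul]
  refine ⟨π, Prod.ext (Equiv.ext fun i => ?_) (funext fun i => ?_)⟩
  · have h1 : π.toColored.1 i = absIndex (f (posElem i)) := rfl
    rw [h1, habs, hidx']
  · have h1 : π.toColored.2 i = if (π.1 (posElem i) : ℤ) < 0 then 1 else 0 := rfl
    rw [h1, hval]
    have h2 := (z i).2
    simp only [signed]
    refine Fin.ext ?_
    split_ifs <;> simp <;> omega

lemma color_le_one (z : Fin n → Fin 2) (i : ℕ) : color z i ≤ 1 := by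
  rcases i with _ | i
  · simp [color]
  · rw [color]
    split_ifs <;> omega

lemma SignedPerm.desR_toColored (π : SignedPerm n) : desR π.toColored = desB π := by
  refine filter_congr fun i hi => ?_
  have hi : i < n := mem_range.1 hi
  have h := π.letter_eq (show i + 1 ≤ n from hi)
  push_cast at h
  have h0 : color π.toColored.2 i ≠ 0 → 0 < QStirlingEulerian.letter π.toColored.1 i := by
    rcases i with _ | i
    · simp [color]
    · rw [letter_succ _ (by omega)]; omega
  have h1 : 0 < QStirlingEulerian.letter π.toColored.1 (i + 1) := by
    rw [letter_succ _ hi]; omega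
  have h2 := color_le_one π.toColored.2 i
  have h3 := color_le_one π.toColored.2 (i + 1)
  rw [h, π.letter_eq hi.le]
  simp only [coloredLetter, gt_iff_lt, rank_lt_rank, signed]
  split_ifs <;> omega

lemma SignedPerm.sum_color (π : SignedPerm n) : ∑ i, (π.toColored.2 i : ℕ) = neg π := by
  rw [neg, card_filter, ← Ico_add_one_right_eq_Icc, sum_Ico_eq_sum_range, Nat.add_sub_cancel,
    sum_range]
  refine sum_congr rfl fun i _ => ?_
  rw [add_comm 1, π.letter_eq (show (i : ℕ) + 1 ≤ n from i.2), letter_succ _ i.2,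
    color_succ _ i.2, signed]
  have := (π.toColored.2 i).2
  simp only [Fin.eta]
  split_ifs <;> omega

lemma eulerianR_two {R : Type*} [CommRing R] (q : R) (n l : ℕ) :
    eulerianR q 2 n l = eulerianB q n l := by
  simp only [eulerianR, eulerianB, sum_filter]
  refine (Fintype.sum_bijective SignedPerm.toColored
    ⟨SignedPerm.toColored_injective, SignedPerm.toColored_surjective⟩ _ _ fun π => ?_).symm
  rw [fmajR, fmajB, π.desR_toColored, π.sum_color, mul_sum]

end TypeB

/-! ### The three identities over `ℚ(q)` -/

lemma qInt_qq_pow_ne_zero {r : ℕ} (n : ℕ) : qInt (qq ^ r) (n + 1) ≠ 0 := by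
  -- The value at `q = 1` is `n + 1`.
  have h : qInt (qq ^ r) (n + 1)
      = algebraMap (Polynomial ℚ) (RatFunc ℚ) (qInt (Polynomial.X ^ r) (n + 1)) := by
    simp [qInt, qq]
  rw [h, Ne, map_eq_zero_iff _ (RatFunc.algebraMap_injective ℚ)]
  intro h0
  have h1 := congrArg (Polynomial.eval 1) h0
  simp [qInt, Polynomial.eval_finsetSum] at h1
  exact absurd h1 (by positivity)

lemma stirlingR_qq_eq_sum {r n k : ℕ} (hr : 1 ≤ r) (hk : k ≤ n) :
    qq ^ (r * k.choose 2 + k) * qInt qq r ^ k * qFactorial (qq ^ r) k * stirlingR qq r n k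
      = ∑ l ∈ range (k + 1), qq ^ (r * k * (k - l)) * eulerianR qq r n l
          * qBinomial (qq ^ r) (n - l) (k - l) := by
  obtain ⟨s, rfl⟩ := Nat.exists_eq_add_of_le' hr
  rw [stirlingR_eq_sum]
  refine sum_congr rfl fun l hl => ?_
  have hl : l ≤ k := by simpa [Nat.lt_succ_iff] using hl
  rw [qBinomial_eq_gaussBinom qInt_qq_pow_ne_zero (by omega), ← pow_mul, mul_assoc (s + 1)]

end QStirlingEulerian

open QStirlingEulerian in
theorem theorem4p2 :
    -- the identity for r-colored permutations
    (∀ r n k : ℕ, 1 ≤ r → k ≤ n →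
      qq ^ ((r : ℤ) * ((k + 1).choose 2 : ℤ) + (1 - (r : ℤ)) * (k : ℤ))
          * qInt qq r ^ k * qFactorial (qq ^ r) k * stirlingR qq r n k
        = ∑ l ∈ Finset.range (k + 1),
            qq ^ (r * k * (k - l)) * eulerianR qq r n l
              * qBinomial (qq ^ r) (n - l) (k - l)) ∧
    -- r = 1: the objects and the identity of type A
    ((∀ n k : ℕ, stirlingR qq 1 n k = stirlingA qq (n + 1) (k + 1)) ∧
      (∀ n l : ℕ, eulerianR qq 1 n l = eulerianA qq n l) ∧
      (∀ n k : ℕ, 1 ≤ n → k ≤ n →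
        qq ^ k.choose 2 * qFactorial qq k * stirlingA qq n k
          = ∑ l ∈ Finset.Icc 1 k,
              qq ^ (k * (k - l)) * eulerianA qq n (l - 1)
                * qBinomial qq (n - l) (k - l))) ∧
    -- r = 2: the objects and the identity of type B
    ((∀ n k : ℕ, stirlingR qq 2 n k = stirlingB qq n k) ∧
      (∀ n l : ℕ, eulerianR qq 2 n l = eulerianB qq n l) ∧
      (∀ n k : ℕ, k ≤ n →
        qInt qq 2 ^ k * qFactorial (qq ^ 2) k * stirlingB qq n k
          = ∑ l ∈ Finset.range (k + 1),
              qq ^ ((k : ℤ) * ((k : ℤ) - 2 * (l : ℤ))) * eulerianB qq n l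
                * qBinomial (qq ^ 2) (n - l) (k - l))) := by
  have hq : qq ≠ 0 := RatFunc.X_ne_zero
  refine ⟨fun r n k hr hk => ?_, ⟨stirlingR_one qq, eulerianR_one qq, fun n k hn hk => ?_⟩,
    fun n k => rfl, eulerianR_two qq, fun n k hk => ?_⟩
  · rw [← stirlingR_qq_eq_sum hr hk, ← zpow_natCast qq (r * k.choose 2 + k)]
    congr 4
    rw [Nat.choose_succ_succ' k 1, Nat.choose_one_right]
    push_cast
    ring
  · rw [stirlingA_eq_sum qq hn]
    refine sum_congr rfl fun l hl => ?_
    have hl := mem_Icc.1 hl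
    rw [qBinomial_eq_gaussBinom (fun m => by simpa using qInt_qq_pow_ne_zero (r := 1) m)
      (by omega)]
  · have h := stirlingR_qq_eq_sum (r := 2) (by omega) hk
    have hexp : 2 * k.choose 2 + k = k * k := by
      rw [Nat.choose_two_right, Nat.mul_div_cancel' (Nat.even_mul_pred_self k).two_dvd]
      cases k <;> simp; ring
    -- Both sides of the identity for `r = 2` are divided by `q ^ (k * k)`.
    refine mul_left_cancel₀ (pow_ne_zero (k * k) hq) ?_
    rw [hexp, mul_assoc, mul_assoc, ← mul_assoc (qInt qq 2 ^ k)] at h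
    rw [show stirlingB qq n k = stirlingR qq 2 n k from rfl, h, mul_sum]
    refine sum_congr rfl fun l hl => ?_
    have hl : l ≤ k := by simpa [Nat.lt_succ_iff] using hl
    rw [eulerianR_two, ← mul_assoc, ← mul_assoc, ← zpow_natCast qq (2 * k * (k - l)),
      ← zpow_natCast qq (k * k), ← zpow_add₀ hq]
    congr 3
    push_cast [hl]
    ring
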